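/- Let $\mathcal A,\mathcal S$ be finite index sets, let $A=(A_{\alpha s})_{\alpha\in\mathcal A,s\in\mathcal S}$ and $b=(b_s)_{s\in\mathcal S}$ be complex numbers with $\sum_s b_s=1$. For $c=(c_\alpha)_{\alpha\in\mathcal A}\in\mathbf C^{\mathcal A}$ and $n\ge 1$ put $$S_1(A,b,c;n)=\sum_{(n_s)_s\in\mathbf N^{\mathcal S},\ \sum_s n_s=n}\binom{n}{(n_s)_s}\Big(\prod_s b_s^{n_s}\Big)\exp\Big(n\sum_\alpha c_\alpha\Big(\tfrac1n\sum_s A_{\alpha s}n_s\Big)^2\Big),$$ and, with principal square roots and the principal logarithm, $$\Phi_c(y)=-\tfrac14\sum_\alpha y_\alpha^2+\log Z_c(y),\qquad Z_c(y)=\sum_s b_s\exp\Big(\sum_\alpha\sqrt{c_\alpha}A_{\alpha s}y_\alpha\Big),\qquad y\in\mathbf C^{\mathcal A},$$ $$T_c(y)_\alpha=\frac{2\sqrt{c_\alpha}\sum_s b_sA_{\alpha s}\exp\big(\sum_{\alpha'}\sqrt{c_{\alpha'}}A_{\alpha' s}y_{\alpha'}\big)}{\sum_s b_s\exp\big(\sum_{\alpha'}\sqrt{c_{\alpha'}}A_{\alpha'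 s}y_{\alpha'}\big)}.$$ Proposition. There are constants $c_0,r>0$ and $K$, depending only on $A$ and $b$, such that the following holds. 1. For every $n\ge1$ the function $c\mapsto S_1(A,b,c;n)$ has no zero on the polydisc $\{c:|c_\alpha|\le c_0\ \forall\alpha\}$. Below, $\log S_1(A,b,c;n)$ denotes its logarithm on this polydisc that is continuous in $c$ and equals $0$ at $c=0$ (where $S_1=1$). 2. Let $0<\varepsilon\le c_0$, let $c\in\mathbf C^{\mathcal A}$ with $|c_\alpha|\le\varepsilon$ for all $\alpha$, and let $D=\{y\in\mathbf C^{\mathcal A}:|y_\alpha|\le r/\sqrt\varepsilon\ \forall\alpha\}$. Then $Z_c$ takes no value in $(-\infty,0]$ on $D$ (so $\Phi_c$ is holomorphic there); $\Phi_c$ has exactly one critical point $y^*=y^*(c)$ in $D$, it does not depend on $\varepsilon$, and it is also the unique fixed point of $T_c$ in $D$; and $$\lim_{n\to\infty}\frac{\log S_1(A,b,c;n)}{n}=\Phi_c(y^*).$$ Moreover, for all $\alpha$, $$\Big|y^*_\alpha-2\sqrt{c_\alpha}\sum_s b_sA_{\alpha s}\Big|\le K\varepsilon^{3/2},\qquad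 \Big|\lim_{n\to\infty}\frac{\log S_1(A,b,c;n)}{n}-\sum_\alpha c_\alpha\Big(\sum_s b_sA_{\alpha s}\Big)^2\Big|\le K\varepsilon^{3/2}.$$ -/

import Mathlib

noncomputable section

namespace GenMultinomial

variable {𝒜 𝒮 : Type*} [Fintype 𝒜] [Fintype 𝒮]

/-- The generalized multinomial sum `S_q(A, b, c; n)`: the sum over all families of natural numbers
`k = (k_s)` with total `n` of
`n! / ∏ k_s! * ∏ b_s ^ k_s * exp (n * ∑_α c_α * ((1 / n) * ∑_s A_{α s} k_s) ^ (2 ^ q))`. -/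
def genMultinomialSum [DecidableEq 𝒮] (q : ℕ) (A : 𝒜 → 𝒮 → ℂ) (b : 𝒮 → ℂ) (c : 𝒜 → ℂ)
    (n : ℕ) : ℂ :=
  ∑ k ∈ Finset.piAntidiag (Finset.univ : Finset 𝒮) n,
    (Nat.multinomial Finset.univ k : ℂ) * (∏ s, b s ^ k s) *
      Complex.exp ((n : ℂ) * ∑ α, c α * ((1 / (n : ℂ)) * ∑ s, A α s * (k s : ℂ)) ^ (2 ^ q))

/-- The principal square root on `ℂ` (with argument in `(-π/2, π/2]`, and `0` at `0`). -/
def csqrt (z : ℂ) : ℂ := z ^ (1 / 2 : ℂ)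

/-- `exp (∑_α √c_α A_{α s} y_α)`. -/
def weight (A : 𝒜 → 𝒮 → ℂ) (c : 𝒜 → ℂ) (y : 𝒜 → ℂ) (s : 𝒮) : ℂ :=
  Complex.exp (∑ α, csqrt (c α) * A α s * y α)

/-- `∑_s b_s exp (∑_α √c_α A_{α s} y_α)`, the argument of the logarithm in `Φ`. -/
def partitionFn (A : 𝒜 → 𝒮 → ℂ) (b : 𝒮 → ℂ) (c : 𝒜 → ℂ) (y : 𝒜 → ℂ) : ℂ :=
  ∑ s, b s * weight A c y s

/-- `Φ(y) = -¼ ∑_α y_α² + log ∑_s b_s exp (∑_α √c_α A_{α s} y_α)`, with the principal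
logarithm. -/
def phi (A : 𝒜 → 𝒮 → ℂ) (b : 𝒮 → ℂ) (c : 𝒜 → ℂ) (y : 𝒜 → ℂ) : ℂ :=
  -(1 / 4) * ∑ α, y α ^ 2 + Complex.log (partitionFn A b c y)

/-- The self-map of `ℂ^𝒜` whose `α`-component is
`2 √c_α ∑_s b_s A_{α s} exp (∑_α' √c_α' A_{α' s} y_α') / ∑_s b_s exp (∑_α' √c_α' A_{α' s} y_α')`. -/
def fixedPointMap (A : 𝒜 → 𝒮 → ℂ) (b : 𝒮 → ℂ) (c : 𝒜 → ℂ) (y : 𝒜 → ℂ) : 𝒜 → ℂ :=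
  fun α => 2 * csqrt (c α) * (∑ s, b s * A α s * weight A c y s) / partitionFn A b c y

/-- `y` is a critical point of `f`: `f` is complex differentiable at `y` with zero differential. -/
def IsCriticalPoint (f : (𝒜 → ℂ) → ℂ) (y : 𝒜 → ℂ) : Prop :=
  HasFDerivAt f (0 : (𝒜 → ℂ) →L[ℂ] ℂ) y

/-- The closed polydisc `{y : |y_α| ≤ R for all α}`. -/
def polydisc (𝒜 : Type*) (R : ℝ) : Set (𝒜 → ℂ) := {y | ∀ α, ‖y α‖ ≤ R}

/-- `L` is the family (indexed by `n ≥ 1`) of determinations of `c ↦ log S_1(A, b, c; n)` on the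
polydisc of radius `c₀` that are continuous in `c` and vanish at `c = 0`, where `S_1 = 1`. As the
polydisc is connected, there is at most one such determination for each `n ≥ 1`, and there is one
only if `S_1(A, b, c; n)` has no zero there. -/
def IsContinuousLogS1 [DecidableEq 𝒮] (A : 𝒜 → 𝒮 → ℂ) (b : 𝒮 → ℂ) (c₀ : ℝ)
    (L : ℕ → (𝒜 → ℂ) → ℂ) : Prop :=
  ∀ n : ℕ, 1 ≤ n →
    ContinuousOn (L n) (polydisc 𝒜 c₀) ∧ L n 0 = 0 ∧
      ∀ c ∈ polydisc 𝒜 c₀, Complex.exp (L n c) = genMultinomialSum 1 A b c n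

end GenMultinomial

end

namespace GenMultinomial

open MeasureTheory ProbabilityTheory Topology

/-! A Gaussian average linearises the quadratic exponent: `exp (z ^ 2 / 2)` is the mean of `exp (z
g)`, so the multinomial theorem turns the sum into the Gaussian mean of the `n`-th power of a
Laplace transform evaluated at scale `n ^ (-1/2)` (`genMultinomialSum_one_eq_integral`). When `A` is
centred under the weights, the linear term of that transform vanishes and the `n`-th power stays
close to `1` uniformly in `n`; for small `c` the sum then lies within `1/2` of `1`
(`exists_norm_genMultinomialSum_sub_one_le`).

The general case reduces to the centred one without contour deformation. Writing `x ^ 2 = (x - m) ^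
2 + 2 m x - m ^ 2` extracts `exp (n * meanFieldEnergy)` and tilts the weights by `u = 2 c m`
(`genMultinomialSum_one_eq_exp_mul`). The remaining sum is centred exactly when `m` equals the
tilted mean, an equation solved by contraction for small `c` (`exists_fixedPoint_two_mul_mul`).
Hence `log S_1` is `n` times the energy plus a bounded term.

Under `y = 2 √c m` this equation becomes the fixed point equation of `T_c`. It is also the critical
point equation of `Φ_c`, whose gradient is `(T_c y - y) / 2`, and the energy is the critical value.
-/

/-! ### Gaussian linearisation of the quadratic exponent. -/

/-- The standard Gaussian measure on `ℝ^𝒜`. -/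
noncomputable abbrev stdGaussianPi (𝒜 : Type*) [Fintype 𝒜] : Measure (𝒜 → ℝ) :=
  Measure.pi fun _ => gaussianReal 0 1

theorem integral_cexp_stdGaussianPi {𝒜 : Type*} [Fintype 𝒜] (z : 𝒜 → ℂ) :
    ∫ g, Complex.exp (∑ α, z α * (g α : ℂ)) ∂(stdGaussianPi 𝒜) =
      Complex.exp (∑ α, z α ^ 2 / 2) := by
  simp_rw [Complex.exp_sum]
  rw [integral_fintype_prod_eq_prod (f := fun α (x : ℝ) => Complex.exp (z α * (x : ℂ)))]
  refine Finset.prod_congr rfl fun α _ => ?_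
  have h := complexMGF_id_gaussianReal (μ := 0) (v := 1) (z α)
  simpa [complexMGF] using h

theorem integrable_cexp_stdGaussianPi {𝒜 : Type*} [Fintype 𝒜] (z : 𝒜 → ℂ) :
    Integrable (fun g => Complex.exp (∑ α, z α * (g α : ℂ))) (stdGaussianPi 𝒜) := by
  simp_rw [Complex.exp_sum]
  refine Integrable.fintype_prod (f := fun α (x : ℝ) => Complex.exp (z α * (x : ℂ))) fun α => ?_
  have h := integrable_cexp_mul_of_re_mem_integrableExpSet (X := id) (μ := gaussianReal 0 1)
    (z := z α) (by fun_prop) (by simp [integrableExpSet, integrable_exp_mul_gaussianReal])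
  simpa using h

/-- Supplies the integrable majorant, independent of `n` and `c`, for the centred estimate. -/
theorem exists_integrable_exp_sum_sq (𝒜 : Type*) [Fintype 𝒜] :
    ∃ κ : ℝ, 0 < κ ∧
      Integrable (fun g : 𝒜 → ℝ => Real.exp (κ * ∑ α, g α ^ 2)) (stdGaussianPi 𝒜) := by
  obtain ⟨κ, hκ, h⟩ := IsGaussian.exists_integrable_exp_sq (gaussianReal 0 1)
  refine ⟨κ, hκ, ?_⟩
  simp_rw [Finset.mul_sum, Real.exp_sum]
  refine Integrable.fintype_prod (f := fun _ (x : ℝ) => Real.exp (κ * x ^ 2)) fun α => ?_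
  simpa using h

theorem csqrt_sq (z : ℂ) : csqrt z ^ 2 = z := by
  rw [csqrt, ← Complex.cpow_nat_mul]; norm_num

theorem norm_csqrt (z : ℂ) : ‖csqrt z‖ = √‖z‖ := by
  rw [eq_comm, Real.sqrt_eq_iff_mul_self_eq (norm_nonneg _) (norm_nonneg _), ← norm_mul, ← sq,
    csqrt_sq]

/-- Hubbard–Stratonovich: with `X_α = ∑ s, A α s * k s` and `z_α = csqrt (2 c_α / n) X_α`, one has
`z_α ^ 2 / 2 = n c_α (X_α / n) ^ 2`. Since `X` is linear in `k`, the linearised exponential is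
absorbed into the weights. -/
theorem genMultinomialSum_one_eq_integral {𝒜 𝒮 : Type*} [Fintype 𝒜] [Fintype 𝒮] [DecidableEq 𝒮]
    (A : 𝒜 → 𝒮 → ℂ) (w : 𝒮 → ℂ) (c : 𝒜 → ℂ) {n : ℕ} (hn : n ≠ 0) :
    genMultinomialSum 1 A w c n =
      ∫ g, (∑ s, w s * Complex.exp (∑ α, csqrt (2 * c α / n) * (g α : ℂ) * A α s)) ^ n
        ∂(stdGaussianPi 𝒜) := by
  have hn' : (n : ℂ) ≠ 0 := by exact_mod_cast hn
  have key : ∀ (g : 𝒜 → ℝ) (k : 𝒮 → ℕ),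
      ((Nat.multinomial Finset.univ k : ℕ) : ℂ) *
        ∏ s, (w s * Complex.exp (∑ α, csqrt (2 * c α / n) * (g α : ℂ) * A α s)) ^ k s =
      (((Nat.multinomial Finset.univ k : ℕ) : ℂ) * ∏ s, w s ^ k s) *
        Complex.exp (∑ α, (csqrt (2 * c α / n) * ∑ s, A α s * (k s : ℂ)) * (g α : ℂ)) := by
    intro g k
    simp_rw [mul_pow]
    rw [Finset.prod_mul_distrib, mul_assoc]
    congr 2
    simp_rw [← Complex.exp_nat_mul]
    rw [← Complex.exp_sum]
    congr 1
    simp_rw [Finset.mul_sum, Finset.sum_mul]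
    rw [Finset.sum_comm]
    refine Finset.sum_congr rfl fun α _ => Finset.sum_congr rfl fun s _ => ?_
    ring
  simp_rw [Finset.sum_pow_eq_sum_piAntidiag, key]
  rw [integral_finsetSum _ fun k _ => (integrable_cexp_stdGaussianPi _).const_mul _]
  refine Finset.sum_congr rfl fun k _ => ?_
  rw [integral_const_mul, integral_cexp_stdGaussianPi]
  congr 2
  rw [Finset.mul_sum]
  refine Finset.sum_congr rfl fun α _ => ?_
  rw [mul_pow _ _ 2, csqrt_sq, pow_one]
  field_simp

/-! ### The centred sum is close to `1`, uniformly in `n`. -/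

theorem norm_one_add_pow_sub_one_le (x : ℂ) (n : ℕ) : ‖(1 + x) ^ n - 1‖ ≤ (1 + ‖x‖) ^ n - 1 := by
  induction n with
  | zero => simp
  | succ n ih =>
    have h1 : (1 + x) ^ (n + 1) - 1 = ((1 + x) ^ n - 1) * (1 + x) + x := by ring
    have h2 : ‖1 + x‖ ≤ 1 + ‖x‖ := (norm_add_le _ _).trans (by simp)
    rw [h1]
    calc _ ≤ ‖(1 + x) ^ n - 1‖ * ‖1 + x‖ + ‖x‖ := (norm_add_le _ _).trans (by rw [norm_mul])
      _ ≤ ((1 + ‖x‖) ^ n - 1) * (1 + ‖x‖) + ‖x‖ := by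
          have := (norm_nonneg _).trans ih
          gcongr
      _ = _ := by ring

/-- The exponent must be purely quadratic in `t`, because `t` will be of order `n ^ (-1/2)` and the
bound is raised to the power `n`. Small `t` uses `1 + x ≤ exp x`; for `t ≥ 1` the linear exponent is
dominated by `t ^ 2`. -/
theorem one_add_mul_sq_mul_exp_le {W t : ℝ} (hW : 0 ≤ W) (ht : 0 ≤ t) :
    1 + W * (t ^ 2 * Real.exp t) ≤ Real.exp ((3 * W + 2) * t ^ 2) := by
  rcases le_total t 1 with h | h
  · have h1 : Real.exp t ≤ 3 :=
      (Real.exp_le_exp.2 h).trans (Real.exp_one_lt_d9.le.trans (by norm_num))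
    calc 1 + W * (t ^ 2 * Real.exp t) ≤ (3 * W + 2) * t ^ 2 + 1 := by
          have : W * (t ^ 2 * Real.exp t) ≤ W * (t ^ 2 * 3) := by gcongr
          nlinarith [sq_nonneg t]
      _ ≤ _ := Real.add_one_le_exp _
  · have h1 : t ^ 2 ≤ 2 * Real.exp t := by
      have := Real.quadratic_le_exp_of_nonneg ht
      linarith
    have h2 : 1 ≤ Real.exp (2 * t) := Real.one_le_exp (by linarith)
    have h3 : Real.exp t * Real.exp t = Real.exp (2 * t) := by rw [← Real.exp_add]; ring_nf
    calc 1 + W * (t ^ 2 * Real.exp t) ≤ Real.exp (2 * t) + W * (2 * Real.exp (2 * t)) := by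
          rw [← h3, ← mul_assoc 2]
          rw [← h3] at h2
          gcongr
      _ = (2 * W + 1) * Real.exp (2 * t) := by ring
      _ ≤ Real.exp (2 * W) * Real.exp (2 * t) := by
          gcongr; exact Real.add_one_le_exp _
      _ = Real.exp (2 * W + 2 * t) := (Real.exp_add _ _).symm
      _ ≤ _ := by
          apply Real.exp_le_exp.2
          nlinarith [mul_nonneg hW (sq_nonneg t), mul_nonneg hW (sub_nonneg.2 h)]

/-- Centring `hwx` removes the first-order term, so only the second-order Taylor remainder of `exp`
contributes. -/
theorem norm_sum_mul_cexp_pow_sub_one_le {𝒮 : Type*} [Fintype 𝒮] {w x : 𝒮 → ℂ} {W t : ℝ}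
    (hw : ∑ s, w s = 1) (hwx : ∑ s, w s * x s = 0) (hW : ∑ s, ‖w s‖ ≤ W)
    (hx : ∀ s, ‖x s‖ ≤ t) (ht : 0 ≤ t) (n : ℕ) :
    ‖(∑ s, w s * Complex.exp (x s)) ^ n - 1‖ ≤ Real.exp (n * ((3 * W + 2) * t ^ 2)) - 1 := by
  have hW0 : 0 ≤ W := (Finset.sum_nonneg fun _ _ => norm_nonneg _).trans hW
  have h1 : ‖∑ s, w s * (Complex.exp (x s) - (1 + x s))‖ ≤ W * (t ^ 2 * Real.exp t) := by
    calc _ ≤ ∑ s, ‖w s‖ * (t ^ 2 * Real.exp t) := by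
          refine norm_sum_le_of_le _ fun s _ => ?_
          rw [norm_mul]
          gcongr
          have := Complex.norm_exp_sub_sum_le_norm_mul_exp (x s) 2
          simp only [Finset.sum_range_succ, Finset.sum_range_zero, pow_zero, Nat.factorial,
            Nat.cast_one, div_one, zero_add, pow_one, mul_one] at this
          refine this.trans ?_
          have := hx s
          gcongr
      _ ≤ _ := by rw [← Finset.sum_mul]; gcongr
  have h2 : ∑ s, w s * Complex.exp (x s) = 1 + ∑ s, w s * (Complex.exp (x s) - (1 + x s)) := by
    simp_rw [mul_sub, mul_add, Finset.sum_sub_distrib, Finset.sum_add_distrib, hwx, mul_one, hw]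
    ring
  rw [h2]
  refine (norm_one_add_pow_sub_one_le _ n).trans ?_
  rw [Real.exp_nat_mul]
  gcongr
  exact (by gcongr : _ ≤ 1 + W * (t ^ 2 * Real.exp t)).trans (one_add_mul_sq_mul_exp_le hW0 ht)

/-- Convexity of `exp` between `0` and `κ q`, with weight `η / κ`: the small factor is pulled out of
the exponent. -/
theorem exp_mul_sub_one_le {η κ q : ℝ} (hη : 0 ≤ η) (hκ : 0 < κ) (h : η ≤ κ) :
    Real.exp (η * q) - 1 ≤ η / κ * Real.exp (κ * q) := by
  have hc := convexOn_exp.2 (Set.mem_univ (κ * q)) (Set.mem_univ 0)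
    (div_nonneg hη hκ.le) (sub_nonneg.2 ((div_le_one hκ).2 h)) (by ring)
  have h1 : η / κ * (κ * q) = η * q := by field_simp
  simp only [smul_eq_mul, mul_zero, add_zero, Real.exp_zero, mul_one, h1] at hc
  have : 0 ≤ η / κ := by positivity
  linarith

/-- If the weights `w` have total mass `1` and `A` is centred under `w`, then the generalized
multinomial sum with `q = 1` is close to `1` for small `c`, uniformly in `n`. -/
theorem exists_norm_genMultinomialSum_sub_one_le (𝒜 : Type*) [Fintype 𝒜] (W a : ℝ) :
    ∃ ε₀ : ℝ, 0 < ε₀ ∧ ∀ {𝒮 : Type*} [Fintype 𝒮] [DecidableEq 𝒮] (A : 𝒜 → 𝒮 → ℂ) (w : 𝒮 → ℂ)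
      (c : 𝒜 → ℂ) (n : ℕ), n ≠ 0 → ∑ s, w s = 1 → (∀ α, ∑ s, w s * A α s = 0) →
      ∑ s, ‖w s‖ ≤ W → (∀ α s, ‖A α s‖ ≤ a) → (∀ α, ‖c α‖ ≤ ε₀) →
      ‖genMultinomialSum 1 A w c n - 1‖ ≤ 1 / 2 := by
  obtain ⟨κ, hκ, hint⟩ := exists_integrable_exp_sum_sq 𝒜
  set I : ℝ := ∫ g : 𝒜 → ℝ, Real.exp (κ * ∑ α, g α ^ 2) ∂(stdGaussianPi 𝒜) with hI
  have hI0 : 0 ≤ I := integral_nonneg fun _ => (Real.exp_pos _).le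
  set B : ℝ := (3 * |W| + 2) * (2 * a ^ 2 * Fintype.card 𝒜) with hB
  have hB0 : 0 ≤ B := by positivity
  -- Chosen so that `B * ε₀ / κ * I ≤ 1 / 2` and `B * ε₀ ≤ κ`; the added ones keep the denominators
  -- positive.
  set ε₀ : ℝ := κ / ((B + 1) * (2 * (I + 1))) with hε₀
  have hε0 : 0 < ε₀ := by positivity
  have hη0 : 0 ≤ B * ε₀ := by positivity
  have hη : B * ε₀ / κ ≤ 1 / (2 * (I + 1)) := by
    rw [hε₀, div_le_div_iff₀ hκ (by positivity)]
    have : B * (κ / ((B + 1) * (2 * (I + 1)))) * (2 * (I + 1)) = B / (B + 1) * κ := by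
      field_simp
    rw [this]
    gcongr
    rw [div_le_one (by positivity)]; linarith
  have hηκ : B * ε₀ ≤ κ := by
    rw [← div_le_one hκ]
    refine hη.trans ?_
    rw [div_le_one (by positivity)]; linarith
  refine ⟨ε₀, hε0, ?_⟩
  intro 𝒮 _ _ A w c n hn hw hwA hW hA hc
  have hn0 : (0 : ℝ) < n := by exact_mod_cast Nat.pos_of_ne_zero hn
  have hWW : ∑ s, ‖w s‖ ≤ |W| := hW.trans (le_abs_self W)
  rw [genMultinomialSum_one_eq_integral A w c hn]
  set G : (𝒜 → ℝ) → ℂ := fun g =>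
    (∑ s, w s * Complex.exp (∑ α, csqrt (2 * c α / n) * (g α : ℂ) * A α s)) ^ n with hG
  have hbound : ∀ g, ‖G g - 1‖ ≤ B * ε₀ / κ * Real.exp (κ * ∑ α, g α ^ 2) := by
    intro g
    set t : ℝ := √(2 * ε₀ / n) * |a| * ∑ α, |g α| with ht
    have ht0 : 0 ≤ t := by
      have : 0 ≤ ∑ α, |g α| := Finset.sum_nonneg fun _ _ => abs_nonneg _
      positivity
    have hx : ∀ s, ‖∑ α, csqrt (2 * c α / n) * (g α : ℂ) * A α s‖ ≤ t := by
      intro s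
      rw [ht, Finset.mul_sum]
      refine norm_sum_le_of_le _ fun α _ => ?_
      rw [norm_mul, norm_mul, norm_csqrt, Complex.norm_real, Real.norm_eq_abs, mul_right_comm]
      have h1 : ‖2 * c α / (n : ℂ)‖ ≤ 2 * ε₀ / n := by
        rw [norm_div, norm_mul, Complex.norm_natCast, Complex.norm_ofNat]
        have := hc α
        gcongr
      have h2 := (hA α s).trans (le_abs_self a)
      gcongr
    have hwx : ∑ s, w s * ∑ α, csqrt (2 * c α / n) * (g α : ℂ) * A α s = 0 := by
      simp_rw [Finset.mul_sum]
      rw [Finset.sum_comm]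
      refine Finset.sum_eq_zero fun α _ => ?_
      have := congrArg (fun z => csqrt (2 * c α / n) * (g α : ℂ) * z) (hwA α)
      simp only [Finset.mul_sum, mul_zero] at this
      rw [← this]
      exact Finset.sum_congr rfl fun s _ => by ring
    refine (norm_sum_mul_cexp_pow_sub_one_le hw hwx hWW hx ht0 n).trans ?_
    refine le_trans ?_ (exp_mul_sub_one_le hη0 hκ hηκ)
    refine sub_le_sub_right (Real.exp_le_exp.2 ?_) 1
    have hs : (∑ α, |g α|) ^ 2 ≤ Fintype.card 𝒜 * ∑ α, g α ^ 2 := by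
      have := sq_sum_le_card_mul_sum_sq (s := Finset.univ) (f := fun α => |g α|)
      simpa using this
    -- The factor `n` cancels the `1 / n` inside `t ^ 2`, which makes the bound uniform in `n`.
    calc (n : ℝ) * ((3 * |W| + 2) * t ^ 2)
        = (3 * |W| + 2) * (2 * ε₀ * a ^ 2) * (∑ α, |g α|) ^ 2 := by
          rw [ht, mul_pow, mul_pow, Real.sq_sqrt (by positivity), sq_abs]
          field_simp
      _ ≤ (3 * |W| + 2) * (2 * ε₀ * a ^ 2) * (Fintype.card 𝒜 * ∑ α, g α ^ 2) := by gcongr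
      _ = _ := by rw [hB]; ring
  have hGm : AEStronglyMeasurable G (stdGaussianPi 𝒜) :=
    (by rw [hG]; fun_prop : Continuous G).aestronglyMeasurable
  have hdom : Integrable (fun g : 𝒜 → ℝ => B * ε₀ / κ * Real.exp (κ * ∑ α, g α ^ 2))
    (stdGaussianPi 𝒜) := hint.const_mul _
  have hG1 : Integrable (fun g => G g - 1) (stdGaussianPi 𝒜) :=
    hdom.mono' (hGm.sub aestronglyMeasurable_const) (Filter.Eventually.of_forall hbound)
  have hGi : Integrable G (stdGaussianPi 𝒜) := by
    simpa [Pi.add_def] using hG1.add (integrable_const (1 : ℂ))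
  have h1 : ∫ g, G g ∂(stdGaussianPi 𝒜) - 1 = ∫ g, (G g - 1) ∂(stdGaussianPi 𝒜) := by
    rw [integral_sub hGi (integrable_const _)]; simp
  rw [h1]
  refine (norm_integral_le_of_norm_le hdom (Filter.Eventually.of_forall hbound)).trans ?_
  rw [integral_const_mul, ← hI]
  calc B * ε₀ / κ * I ≤ 1 / (2 * (I + 1)) * I := by gcongr
    _ ≤ 1 / 2 := by
      rw [div_mul_eq_mul_div, div_le_div_iff₀ (by positivity) (by norm_num)]; linarith

/-! ### Tilted weights and the logarithm of the Laplace transform. -/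

variable {𝒜 𝒮 : Type*} [Fintype 𝒜] [Fintype 𝒮]

/-- The Laplace transform `∑_s b_s exp (∑_α u_α A_{α s})`. -/
noncomputable def laplace (A : 𝒜 → 𝒮 → ℂ) (b : 𝒮 → ℂ) (u : 𝒜 → ℂ) : ℂ :=
  ∑ s, b s * Complex.exp (∑ α, u α * A α s)

/-- The weights `b` tilted by `u` and normalised to total mass `1`. -/
noncomputable def tilt (A : 𝒜 → 𝒮 → ℂ) (b : 𝒮 → ℂ) (u : 𝒜 → ℂ) (s : 𝒮) : ℂ :=
  b s * Complex.exp (∑ α, u α * A α s) / laplace A b u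

/-- The mean of `A` under the tilted weights. -/
noncomputable def tiltMean (A : 𝒜 → 𝒮 → ℂ) (b : 𝒮 → ℂ) (u : 𝒜 → ℂ) (α : 𝒜) : ℂ :=
  ∑ s, tilt A b u s * A α s

/-- The linear form `v ↦ ∑_α m_α v_α`. -/
noncomputable def dotCLM (m : 𝒜 → ℂ) : (𝒜 → ℂ) →L[ℂ] ℂ :=
  ∑ α, m α • ContinuousLinearMap.proj (R := ℂ) (φ := fun _ : 𝒜 => ℂ) α

theorem dotCLM_apply (m v : 𝒜 → ℂ) : dotCLM m v = ∑ α, m α * v α := by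
  simp [dotCLM]

theorem norm_dotCLM_sub_le (m m' : 𝒜 → ℂ) :
    ‖dotCLM m - dotCLM m'‖ ≤ Fintype.card 𝒜 * ‖m - m'‖ := by
  refine ContinuousLinearMap.opNorm_le_bound _ (by positivity) fun v => ?_
  rw [sub_apply, dotCLM_apply, dotCLM_apply, ← Finset.sum_sub_distrib]
  calc _ ≤ ∑ _α : 𝒜, ‖m - m'‖ * ‖v‖ := by
        refine norm_sum_le_of_le _ fun α _ => ?_
        rw [← sub_mul, norm_mul]
        gcongr
        · exact norm_le_pi_norm (m - m') α
        · exact norm_le_pi_norm v α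
    _ = _ := by simp [mul_assoc]

variable (A : 𝒜 → 𝒮 → ℂ) (b : 𝒮 → ℂ)

theorem contDiff_laplace : ContDiff ℂ 1 (laplace A b) := by
  unfold laplace; fun_prop

theorem laplace_zero : laplace A b 0 = ∑ s, b s := by simp [laplace]

variable {A b}

theorem contDiffAt_tilt {u : 𝒜 → ℂ} (hu : laplace A b u ≠ 0) (s : 𝒮) :
    ContDiffAt ℂ 1 (fun u => tilt A b u s) u := by
  unfold tilt
  exact ContDiffAt.div (by fun_prop) (contDiff_laplace A b).contDiffAt hu

theorem contDiffAt_tiltMean {u : 𝒜 → ℂ} (hu : laplace A b u ≠ 0) :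
    ContDiffAt ℂ 1 (tiltMean A b) u := by
  refine contDiffAt_pi.2 fun α => ?_
  unfold tiltMean
  exact ContDiffAt.sum fun s _ => (contDiffAt_tilt hu s).mul contDiffAt_const

theorem sum_tilt {u : 𝒜 → ℂ} (hu : laplace A b u ≠ 0) : ∑ s, tilt A b u s = 1 := by
  simp_rw [tilt]
  rw [← Finset.sum_div]
  exact div_self hu

theorem hasFDerivAt_laplace (u : 𝒜 → ℂ) (hu : laplace A b u ≠ 0) :
    HasFDerivAt (laplace A b) (laplace A b u • dotCLM (tiltMean A b u)) u := by
  have h : ∀ s, HasFDerivAt (fun u : 𝒜 → ℂ => b s * Complex.exp (∑ α, u α * A α s))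
      (b s • (Complex.exp (∑ α, u α * A α s) • dotCLM (fun α => A α s))) u := by
    intro s
    refine (HasFDerivAt.cexp ?_).const_mul _
    have := (dotCLM (fun α => A α s)).hasFDerivAt (x := u)
    refine this.congr_of_eventuallyEq (Filter.Eventually.of_forall fun v => ?_)
    simp only [dotCLM_apply]
    exact Finset.sum_congr rfl fun α _ => mul_comm _ _
  refine (HasFDerivAt.fun_sum fun s _ => h s).congr_fderiv ?_
  ext v
  simp only [sum_apply, smul_apply, smul_eq_mul,
    dotCLM_apply, tiltMean, tilt, Finset.mul_sum, Finset.sum_mul]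
  rw [Finset.sum_comm]
  refine Finset.sum_congr rfl fun α _ => Finset.sum_congr rfl fun s _ => ?_
  field_simp

theorem hasFDerivAt_log_laplace {u : 𝒜 → ℂ} (hu : laplace A b u ∈ Complex.slitPlane) :
    HasFDerivAt (fun u => Complex.log (laplace A b u)) (dotCLM (tiltMean A b u)) u := by
  have h0 := Complex.slitPlane_ne_zero hu
  refine ((hasFDerivAt_laplace u h0).clog hu).congr_fderiv ?_
  rw [smul_smul, inv_mul_cancel₀ h0, one_smul]

/-- Everything follows by continuity near `0`, where the transform equals `1`. The last bound is a
first-order Taylor estimate: the derivative of the logarithm is the tilted mean, which is Lipschitz.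
-/
theorem exists_laplace_bounds (hb : ∑ s, b s = 1) :
    ∃ r : ℝ, 0 < r ∧ ∃ (M C W : ℝ) (K : NNReal), 0 ≤ M ∧ 0 ≤ C ∧
      LipschitzOnWith K (tiltMean A b) (Metric.closedBall 0 r) ∧
      ∀ u ∈ Metric.closedBall (0 : 𝒜 → ℂ) r,
        laplace A b u ∈ Complex.slitPlane ∧ ‖tiltMean A b u‖ ≤ M ∧
        ∑ s, ‖tilt A b u s‖ ≤ W ∧
        ‖Complex.log (laplace A b u) - ∑ α, tiltMean A b 0 α * u α‖ ≤ C * ‖u‖ ^ 2 := by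
  have h1 : laplace A b 0 = 1 := by rw [laplace_zero, hb]
  have h0 : laplace A b 0 ≠ 0 := by simp [h1]
  obtain ⟨K, t, ht, hK⟩ := (contDiffAt_tiltMean h0).exists_lipschitzOnWith
  have e1 : ∀ᶠ u in 𝓝 (0 : 𝒜 → ℂ), laplace A b u ∈ Complex.slitPlane :=
    (contDiff_laplace A b).continuous.continuousAt.eventually_mem
      (Complex.isOpen_slitPlane.mem_nhds (by simp [h1]))
  have e2 : ∀ᶠ u in 𝓝 (0 : 𝒜 → ℂ), ‖tiltMean A b u‖ < ‖tiltMean A b 0‖ + 1 :=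
    (contDiffAt_tiltMean h0).continuousAt.norm.eventually_lt_const (by linarith)
  have e3 : ∀ᶠ u in 𝓝 (0 : 𝒜 → ℂ), ∑ s, ‖tilt A b u s‖ < ∑ s, ‖tilt A b 0 s‖ + 1 :=
    (tendsto_finsetSum _ fun s _ => (contDiffAt_tilt h0 s).continuousAt.norm).eventually_lt_const
      (by linarith)
  obtain ⟨r, hr, hball⟩ := Metric.nhds_basis_closedBall.mem_iff.1
    (Filter.inter_mem ht (e1.and (e2.and e3)))
  refine ⟨r, hr, ‖tiltMean A b 0‖ + 1, Fintype.card 𝒜 * K, ∑ s, ‖tilt A b 0 s‖ + 1, K, by positivity,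
    by positivity, hK.mono fun u hu => (hball hu).1, fun u hu => ?_⟩
  obtain ⟨-, h2, h3, h4⟩ := hball hu
  refine ⟨h2, h3.le, h4.le, ?_⟩
  -- Working on the ball of radius `‖u‖` rather than `r` makes the derivative error proportional to
  -- `‖u‖`, hence a quadratic remainder.
  have hsub : Metric.closedBall (0 : 𝒜 → ℂ) ‖u‖ ⊆ Metric.closedBall 0 r :=
    Metric.closedBall_subset_closedBall (by simpa using hu)
  have hz : (0 : 𝒜 → ℂ) ∈ Metric.closedBall (0 : 𝒜 → ℂ) ‖u‖ := by simp
  have key := (convex_closedBall (0 : 𝒜 → ℂ) ‖u‖).norm_image_sub_le_of_norm_hasFDerivWithin_le'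
    (𝕜 := ℂ) (φ := dotCLM (tiltMean A b 0)) (C := Fintype.card 𝒜 * (K * ‖u‖))
    (fun v hv => (hasFDerivAt_log_laplace (hball (hsub hv)).2.1).hasFDerivWithinAt)
    (fun v hv => (norm_dotCLM_sub_le _ _).trans (by
      gcongr
      refine (hK.norm_sub_le (hball (hsub hv)).1 (hball (hsub hz)).1).trans ?_
      have : ‖v‖ ≤ ‖u‖ := by simpa using hv
      rw [sub_zero]
      gcongr)) hz (by simp : u ∈ Metric.closedBall (0 : 𝒜 → ℂ) ‖u‖)
  rw [h1, Complex.log_one, sub_zero, sub_zero, dotCLM_apply] at key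
  refine key.trans_eq (by ring)

/-- Completing the square around an arbitrary `m`: the cross term `2 c m x` tilts the weights, and
normalising them costs `laplace ^ n` because the `k s` add up to `n`. -/
theorem genMultinomialSum_one_eq_exp_mul [DecidableEq 𝒮] (m c : 𝒜 → ℂ)
    (hu : laplace A b (fun α => 2 * c α * m α) ≠ 0) {n : ℕ} (hn : n ≠ 0) :
    genMultinomialSum 1 A b c n =
      Complex.exp (n * (-∑ α, c α * m α ^ 2 +
        Complex.log (laplace A b (fun α => 2 * c α * m α)))) *
      genMultinomialSum 1 (fun α s => A α s - m α) (tilt A b (fun α => 2 * c α * m α)) c n := by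
  have hn' : (n : ℂ) ≠ 0 := by exact_mod_cast hn
  set u : 𝒜 → ℂ := fun α => 2 * c α * m α with hu_def
  unfold genMultinomialSum
  rw [Finset.mul_sum]
  refine Finset.sum_congr rfl fun k hk => ?_
  have hk : ∑ s, (k s : ℂ) = n := by
    have := (Finset.mem_piAntidiag.1 hk).1
    exact_mod_cast this
  have hprod : ∏ s, tilt A b u s ^ k s =
      (∏ s, b s ^ k s) * Complex.exp (∑ α, u α * ∑ s, A α s * (k s : ℂ)) / laplace A b u ^ n := by
    have hk' : ∏ s, laplace A b u ^ k s = laplace A b u ^ n := by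
      rw [Finset.prod_pow_eq_pow_sum]
      congr 1
      exact_mod_cast hk
    simp_rw [tilt, div_pow, mul_pow]
    rw [Finset.prod_div_distrib, Finset.prod_mul_distrib, hk']
    congr 2
    simp_rw [← Complex.exp_nat_mul]
    rw [← Complex.exp_sum]
    congr 1
    simp_rw [Finset.mul_sum]
    rw [Finset.sum_comm]
    refine Finset.sum_congr rfl fun α _ => Finset.sum_congr rfl fun s _ => ?_
    ring
  have hlap : Complex.exp (n * Complex.log (laplace A b u)) = laplace A b u ^ n := by
    rw [Complex.exp_nat_mul, Complex.exp_log hu]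
  have hsum : ∀ α, ∑ s, (A α s - m α) * (k s : ℂ) = ∑ s, A α s * (k s : ℂ) - m α * n := by
    intro α
    simp_rw [sub_mul]
    rw [Finset.sum_sub_distrib, ← Finset.mul_sum, hk]
  have hexp : Complex.exp ((n : ℂ) * ∑ α, c α * ((1 / (n : ℂ)) * ∑ s, A α s * (k s : ℂ)) ^ (2 ^ 1))
      = Complex.exp (n * -∑ α, c α * m α ^ 2) *
        Complex.exp (∑ α, u α * ∑ s, A α s * (k s : ℂ)) *
        Complex.exp ((n : ℂ) * ∑ α, c α *
          ((1 / (n : ℂ)) * ∑ s, (A α s - m α) * (k s : ℂ)) ^ (2 ^ 1)) := by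
    rw [← Complex.exp_add, ← Complex.exp_add]
    congr 1
    simp_rw [hsum, hu_def, ← Finset.sum_neg_distrib, Finset.mul_sum, ← Finset.sum_add_distrib]
    refine Finset.sum_congr rfl fun α _ => ?_
    simp_rw [← Finset.mul_sum, pow_one]
    generalize ∑ s, A α s * (k s : ℂ) = X
    field_simp
    ring
  rw [hexp, hprod, mul_add, Complex.exp_add, hlap]
  have := pow_ne_zero n hu
  field_simp

/-! ### Critical points of `Φ_c` as fixed points of `T_c`. -/

/-- In the variable `m` only `c` itself appears, so the discontinuity of the square root does not
affect continuity in `c`. -/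
theorem csqrt_mul_two_mul_csqrt_mul {𝒜 : Type*} (c m : 𝒜 → ℂ) :
    (fun α => csqrt (c α) * (2 * csqrt (c α) * m α)) = fun α => 2 * c α * m α := by
  funext α
  linear_combination 2 * m α * csqrt_sq (c α)

theorem polydisc_eq_closedBall {R : ℝ} (hR : 0 ≤ R) :
    polydisc 𝒜 R = Metric.closedBall (0 : 𝒜 → ℂ) R := by
  ext y
  simp [polydisc, pi_norm_le_iff_of_nonneg hR]

theorem partitionFn_eq_laplace (A : 𝒜 → 𝒮 → ℂ) (b : 𝒮 → ℂ) (c y : 𝒜 → ℂ) :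
    partitionFn A b c y = laplace A b (fun α => csqrt (c α) * y α) := by
  unfold partitionFn laplace weight
  refine Finset.sum_congr rfl fun s _ => ?_
  congr 2
  exact Finset.sum_congr rfl fun α _ => by ring

theorem fixedPointMap_apply (A : 𝒜 → 𝒮 → ℂ) (b : 𝒮 → ℂ) (c y : 𝒜 → ℂ) (α : 𝒜) :
    fixedPointMap A b c y α =
      2 * csqrt (c α) * tiltMean A b (fun α => csqrt (c α) * y α) α := by
  have hw : ∀ s, weight A c y s = Complex.exp (∑ α, csqrt (c α) * y α * A α s) := by
    intro s
    unfold weight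
    congr 1
    exact Finset.sum_congr rfl fun α _ => by ring
  simp_rw [fixedPointMap, partitionFn_eq_laplace, tiltMean, tilt, hw, mul_div_assoc,
    Finset.sum_div]
  congr 1
  exact Finset.sum_congr rfl fun s _ => by ring

theorem hasFDerivAt_phi (A : 𝒜 → 𝒮 → ℂ) (b : 𝒮 → ℂ) (c y : 𝒜 → ℂ)
    (hy : partitionFn A b c y ∈ Complex.slitPlane) :
    HasFDerivAt (phi A b c) (dotCLM ((1 / 2 : ℂ) • (fixedPointMap A b c y - y))) y := by
  classical
  let S : (𝒜 → ℂ) →L[ℂ] (𝒜 → ℂ) :=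
    ContinuousLinearMap.pi fun α => csqrt (c α) • ContinuousLinearMap.proj α
  have hS : ∀ y, S y = fun α => csqrt (c α) * y α := fun y => rfl
  rw [partitionFn_eq_laplace] at hy
  have h1 := (hasFDerivAt_log_laplace (u := S y) (by rw [hS]; exact hy)).comp y S.hasFDerivAt
  have h2 : HasFDerivAt (fun y : 𝒜 → ℂ => ∑ α, y α ^ 2) (dotCLM ((2 : ℂ) • y)) y := by
    refine (HasFDerivAt.fun_sum fun α _ =>
      ((ContinuousLinearMap.proj (R := ℂ) (φ := fun _ : 𝒜 => ℂ) α).hasFDerivAt (x := y)).pow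
        2).congr_fderiv ?_
    ext v
    simp [dotCLM_apply]
  refine (((h2.const_mul (-(1 / 4) : ℂ)).add h1).congr_of_eventuallyEq
    (Filter.Eventually.of_forall fun v => ?_)).congr_fderiv ?_
  · simp [phi, partitionFn_eq_laplace, hS]
  · ext v
    simp only [add_apply, smul_apply, ContinuousLinearMap.comp_apply, dotCLM_apply, hS,
      smul_eq_mul, Pi.smul_apply, Pi.sub_apply, fixedPointMap_apply]
    rw [Finset.mul_sum, ← Finset.sum_add_distrib]
    exact Finset.sum_congr rfl fun α _ => by ring

theorem isCriticalPoint_phi_iff (A : 𝒜 → 𝒮 → ℂ) (b : 𝒮 → ℂ) (c y : 𝒜 → ℂ)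
    (hy : partitionFn A b c y ∈ Complex.slitPlane) :
    IsCriticalPoint (phi A b c) y ↔ fixedPointMap A b c y = y := by
  classical
  have h := hasFDerivAt_phi A b c y hy
  constructor
  · intro hc
    have h0 := h.unique hc
    funext α
    have := congrArg (fun f : (𝒜 → ℂ) →L[ℂ] ℂ => f (Pi.single α 1)) h0
    simpa [dotCLM_apply, Pi.single_apply, sub_eq_zero] using this
  · intro hf
    rw [hf, sub_self, smul_zero] at h
    refine HasFDerivAt.congr_fderiv h ?_
    ext v
    simp [dotCLM_apply]

/-! ### The self-consistency equation for the mean. -/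

theorem norm_two_mul_mul_le (c m : 𝒜 → ℂ) : ‖fun α => 2 * c α * m α‖ ≤ 2 * ‖c‖ * ‖m‖ := by
  refine (pi_norm_le_iff_of_nonneg (by positivity)).2 fun α => ?_
  rw [norm_mul, norm_mul, Complex.norm_ofNat]
  gcongr
  · exact norm_le_pi_norm c α
  · exact norm_le_pi_norm m α

theorem norm_two_mul_mul_sub_le (c c' m m' : 𝒜 → ℂ) :
    ‖(fun α => 2 * c α * m α) - fun α => 2 * c' α * m' α‖ ≤
      2 * ‖c - c'‖ * ‖m‖ + 2 * ‖c'‖ * ‖m - m'‖ := by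
  have h : ((fun α => 2 * c α * m α) - fun α => 2 * c' α * m' α) =
      (fun α => 2 * (c - c') α * m α) + fun α => 2 * c' α * (m - m') α := by
    funext α
    simp only [Pi.sub_apply, Pi.add_apply]
    ring
  rw [h]
  exact (norm_add_le _ _).trans
    (add_le_add (norm_two_mul_mul_le _ _) (norm_two_mul_mul_le _ _))

/-- The fixed point of `m ↦ F (2 c m)` exists, is unique, and depends continuously on `c`. -/
theorem exists_fixedPoint_two_mul_mul {F : (𝒜 → ℂ) → (𝒜 → ℂ)} {r M c₀ : ℝ} {K : NNReal}
    (hF : LipschitzOnWith K F (Metric.closedBall 0 r))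
    (hM : ∀ u ∈ Metric.closedBall (0 : 𝒜 → ℂ) r, ‖F u‖ ≤ M) (hM0 : 0 ≤ M) (hc₀ : 0 ≤ c₀)
    (h1 : 2 * c₀ * M ≤ r) (h2 : 2 * c₀ * K ≤ 1 / 2) :
    ∃ μ : (𝒜 → ℂ) → (𝒜 → ℂ), ContinuousOn μ (Metric.closedBall 0 c₀) ∧
      ∀ c ∈ Metric.closedBall (0 : 𝒜 → ℂ) c₀, ‖μ c‖ ≤ M ∧ F (fun α => 2 * c α * μ c α) = μ c ∧
        ∀ m, ‖m‖ ≤ M → F (fun α => 2 * c α * m α) = m → m = μ c := by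
  have hmem : ∀ c ∈ Metric.closedBall (0 : 𝒜 → ℂ) c₀, ∀ m : 𝒜 → ℂ, ‖m‖ ≤ M →
      (fun α => 2 * c α * m α) ∈ Metric.closedBall (0 : 𝒜 → ℂ) r := by
    intro c hc m hm
    rw [mem_closedBall_zero_iff] at hc ⊢
    refine (norm_two_mul_mul_le c m).trans (le_trans ?_ h1)
    gcongr
  have hlip : ∀ c ∈ Metric.closedBall (0 : 𝒜 → ℂ) c₀, ∀ c' ∈ Metric.closedBall (0 : 𝒜 → ℂ) c₀,
      ∀ m m' : 𝒜 → ℂ, ‖m‖ ≤ M → ‖m'‖ ≤ M →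
      ‖F (fun α => 2 * c α * m α) - F (fun α => 2 * c' α * m' α)‖ ≤
        2 * K * M * ‖c - c'‖ + 1 / 2 * ‖m - m'‖ := by
    intro c hc c' hc' m m' hm hm'
    refine (hF.norm_sub_le (hmem c hc m hm) (hmem c' hc' m' hm')).trans ?_
    have hc1 : ‖c'‖ ≤ c₀ := by simpa using hc'
    calc _ ≤ (K : ℝ) * (2 * ‖c - c'‖ * M + 2 * c₀ * ‖m - m'‖) := by
          refine mul_le_mul_of_nonneg_left ((norm_two_mul_mul_sub_le c c' m m').trans ?_) K.2
          gcongr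
      _ = 2 * K * M * ‖c - c'‖ + (2 * c₀ * K) * ‖m - m'‖ := by ring
      _ ≤ _ := by gcongr
  have hex : ∀ c ∈ Metric.closedBall (0 : 𝒜 → ℂ) c₀, ∃ m : 𝒜 → ℂ, ‖m‖ ≤ M ∧
      F (fun α => 2 * c α * m α) = m := by
    intro c hc
    have hmaps : Set.MapsTo (fun m : 𝒜 → ℂ => F (fun α => 2 * c α * m α))
        (Metric.closedBall 0 M) (Metric.closedBall 0 M) := by
      intro m hm
      rw [mem_closedBall_zero_iff] at hm ⊢
      exact hM _ (hmem c hc m hm)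
    have hcontr : ContractingWith (1 / 2) (hmaps.restrict _ _ _) := by
      refine ⟨by rw [← NNReal.coe_lt_coe]; norm_num, LipschitzWith.of_dist_le_mul ?_⟩
      rintro ⟨m, hm⟩ ⟨m', hm'⟩
      rw [mem_closedBall_zero_iff] at hm hm'
      simp only [Subtype.dist_eq, Set.MapsTo.val_restrict_apply, dist_eq_norm]
      simpa using hlip c hc c hc m m' hm hm'
    obtain ⟨m, hm, hfix, -⟩ := hcontr.exists_fixedPoint' Metric.isClosed_closedBall.isComplete
      hmaps (x := 0) (by simpa using hM0) (edist_ne_top _ _)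
    exact ⟨m, by simpa using hm, hfix⟩
  choose! μ hμ1 hμ2 using hex
  refine ⟨μ, ?_, fun c hc => ⟨hμ1 c hc, hμ2 c hc, fun m hm hfix => ?_⟩⟩
  -- The constant comes from absorbing the last term of `d ≤ 2 K M ‖c - c'‖ + d / 2`, where `d` is
  -- the distance between the two fixed points.
  · refine (LipschitzOnWith.of_dist_le_mul (K := 4 * K * ⟨M, hM0⟩)
      fun c hc c' hc' => ?_).continuousOn
    have := hlip c hc c' hc' (μ c) (μ c') (hμ1 c hc) (hμ1 c' hc')
    rw [hμ2 c hc, hμ2 c' hc'] at this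
    rw [dist_eq_norm, dist_eq_norm]
    change _ ≤ 4 * K * M * ‖c - c'‖
    linarith
  · have := hlip c hc c hc m (μ c) hm (hμ1 c hc)
    rw [hfix, hμ2 c hc] at this
    simp only [sub_self, norm_zero, mul_zero, zero_add] at this
    rw [← sub_eq_zero, ← norm_le_zero_iff]
    linarith

/-! ### The energy and the continuous logarithm of the sum. -/

theorem continuous_genMultinomialSum [DecidableEq 𝒮] (q : ℕ) (A : 𝒜 → 𝒮 → ℂ) (b : 𝒮 → ℂ) (n : ℕ) :
    Continuous fun c => genMultinomialSum q A b c n := by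
  unfold genMultinomialSum
  fun_prop

theorem genMultinomialSum_zero [DecidableEq 𝒮] (q : ℕ) (A : 𝒜 → 𝒮 → ℂ) (b : 𝒮 → ℂ) (n : ℕ) :
    genMultinomialSum q A b 0 n = (∑ s, b s) ^ n := by
  simp [genMultinomialSum, Finset.sum_pow_eq_sum_piAntidiag]

/-- The value `-∑_α c_α m_α² + log ∑_s b_s exp (2 ∑_α c_α m_α A_{α s})` of `Φ_c` at
`y_α = 2 √c_α m_α`. -/
noncomputable def meanFieldEnergy (A : 𝒜 → 𝒮 → ℂ) (b : 𝒮 → ℂ) (c m : 𝒜 → ℂ) : ℂ :=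
  -∑ α, c α * m α ^ 2 + Complex.log (laplace A b (fun α => 2 * c α * m α))

theorem phi_two_mul_csqrt_mul (A : 𝒜 → 𝒮 → ℂ) (b : 𝒮 → ℂ) (c m : 𝒜 → ℂ) :
    phi A b c (fun α => 2 * csqrt (c α) * m α) = meanFieldEnergy A b c m := by
  rw [phi, meanFieldEnergy, partitionFn_eq_laplace, csqrt_mul_two_mul_csqrt_mul]
  congr 1
  rw [Finset.mul_sum, ← Finset.sum_neg_distrib]
  refine Finset.sum_congr rfl fun α _ => ?_
  linear_combination -m α ^ 2 * csqrt_sq (c α)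

/-- After completing the square around the untilted mean `m₀`, the error `m - m₀` enters only
quadratically, and the other term is the Taylor remainder of the logarithm. Both are `O(ε ^ 2)`. -/
theorem norm_meanFieldEnergy_sub_le {A : 𝒜 → 𝒮 → ℂ} {b : 𝒮 → ℂ} {c m : 𝒜 → ℂ} {ε M C κ : ℝ}
    (hε : ε ≤ 1) (hC : 0 ≤ C) (hc : ‖c‖ ≤ ε) (hm : ‖m‖ ≤ M)
    (hlog : ‖Complex.log (laplace A b (fun α => 2 * c α * m α)) -
      ∑ α, tiltMean A b 0 α * (2 * c α * m α)‖ ≤ C * ‖fun α => 2 * c α * m α‖ ^ 2)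
    (hdiff : ‖m - tiltMean A b 0‖ ≤ κ * ε) :
    ‖meanFieldEnergy A b c m - ∑ α, c α * tiltMean A b 0 α ^ 2‖ ≤
      (4 * C * M ^ 2 + Fintype.card 𝒜 * κ ^ 2) * ε ^ 2 := by
  have hε0 : 0 ≤ ε := (norm_nonneg _).trans hc
  have hM0 : 0 ≤ M := (norm_nonneg _).trans hm
  set m₀ := tiltMean A b 0
  have h : meanFieldEnergy A b c m - ∑ α, c α * m₀ α ^ 2 =
      (Complex.log (laplace A b (fun α => 2 * c α * m α)) - ∑ α, m₀ α * (2 * c α * m α)) -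
        ∑ α, c α * (m - m₀) α ^ 2 := by
    have hs : ∑ α, c α * (m - m₀) α ^ 2 = ∑ α, c α * m α ^ 2 -
        ∑ α, m₀ α * (2 * c α * m α) + ∑ α, c α * m₀ α ^ 2 := by
      rw [← Finset.sum_sub_distrib, ← Finset.sum_add_distrib]
      refine Finset.sum_congr rfl fun α _ => ?_
      simp only [Pi.sub_apply]
      ring
    rw [hs, meanFieldEnergy]
    ring
  rw [h]
  have h1 : C * ‖fun α => 2 * c α * m α‖ ^ 2 ≤ C * (2 * ε * M) ^ 2 := by
    have := norm_two_mul_mul_le c m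
    have : ‖fun α => 2 * c α * m α‖ ≤ 2 * ε * M := this.trans (by gcongr)
    gcongr
  have h2 : ‖∑ α, c α * (m - m₀) α ^ 2‖ ≤ Fintype.card 𝒜 * (κ ^ 2 * ε ^ 2) := by
    calc _ ≤ ∑ _α : 𝒜, 1 * (κ * ε) ^ 2 := by
          refine norm_sum_le_of_le _ fun α _ => ?_
          rw [norm_mul, norm_pow]
          have e1 := ((norm_le_pi_norm c α).trans hc).trans hε
          have e2 := (norm_le_pi_norm (m - m₀) α).trans hdiff
          gcongr
      _ = _ := by simp [mul_pow]
  calc _ ≤ C * (2 * ε * M) ^ 2 + Fintype.card 𝒜 * (κ ^ 2 * ε ^ 2) :=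
        (norm_sub_le _ _).trans (add_le_add (hlog.trans h1) h2)
    _ = _ := by ring

theorem tendsto_mul_add_log_div {z : ℕ → ℂ} (φ : ℂ) (hz : ∀ n, n ≠ 0 → ‖z n - 1‖ ≤ 1 / 2) :
    Filter.Tendsto (fun n : ℕ => (n * φ + Complex.log (z n)) / (n : ℂ)) Filter.atTop (𝓝 φ) := by
  have hlog : ∀ n, n ≠ 0 → ‖Complex.log (z n)‖ ≤ 1 := by
    intro n hn
    have := Complex.norm_log_one_add_half_le_self (hz n hn)
    rw [add_sub_cancel] at this
    have := hz n hn
    linarith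
  have h0 : Filter.Tendsto (fun n : ℕ => Complex.log (z n) / (n : ℂ)) Filter.atTop (𝓝 0) := by
    refine squeeze_zero_norm' ?_ tendsto_one_div_atTop_nhds_zero_nat
    filter_upwards [Filter.eventually_ne_atTop 0] with n hn
    rw [norm_div, Complex.norm_natCast]
    have := hlog n hn
    gcongr
  have h1 : Filter.Tendsto (fun n : ℕ => φ + Complex.log (z n) / (n : ℂ)) Filter.atTop (𝓝 φ) := by
    simpa using h0.const_add φ
  refine h1.congr' ?_
  filter_upwards [Filter.eventually_ne_atTop 0] with n hn
  have : (n : ℂ) ≠ 0 := by exact_mod_cast hn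
  field_simp

/-- The factor `R n c` stays in a disc around `1` inside the slit plane, so its principal logarithm
is continuous and no branch has to be tracked. -/
theorem isContinuousLogS1_mul_add_log [DecidableEq 𝒮] {A : 𝒜 → 𝒮 → ℂ} {b : 𝒮 → ℂ}
    (hb : ∑ s, b s = 1) {c₀ : ℝ} (hc₀ : 0 ≤ c₀) {φ : (𝒜 → ℂ) → ℂ} {R : ℕ → (𝒜 → ℂ) → ℂ}
    (hφ : ContinuousOn φ (Metric.closedBall 0 c₀)) (hφ0 : φ 0 = 0)
    (hR : ∀ n, n ≠ 0 → ∀ c ∈ Metric.closedBall (0 : 𝒜 → ℂ) c₀,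
      genMultinomialSum 1 A b c n = Complex.exp (n * φ c) * R n c)
    (hR1 : ∀ n, n ≠ 0 → ∀ c ∈ Metric.closedBall (0 : 𝒜 → ℂ) c₀, ‖R n c - 1‖ ≤ 1 / 2) :
    IsContinuousLogS1 A b c₀ (fun n c => n * φ c + Complex.log (R n c)) := by
  intro n hn
  have hn0 : n ≠ 0 := by omega
  rw [polydisc_eq_closedBall hc₀]
  have hslit : ∀ c ∈ Metric.closedBall (0 : 𝒜 → ℂ) c₀, R n c ∈ Complex.slitPlane := by
    intro c hc
    have := Complex.mem_slitPlane_of_norm_lt_one ((hR1 n hn0 c hc).trans_lt (by norm_num))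
    rwa [add_sub_cancel] at this
  have hRc : ContinuousOn (R n) (Metric.closedBall 0 c₀) := by
    -- Continuity of `R n` is read off from the quotient of the sum by `exp (n * φ c)`.
    have h : ContinuousOn (fun c => genMultinomialSum 1 A b c n * Complex.exp (-(n * φ c)))
        (Metric.closedBall 0 c₀) :=
      (continuous_genMultinomialSum 1 A b n).continuousOn.mul
        (continuousOn_const.mul hφ).neg.cexp
    refine h.congr fun c hc => ?_
    beta_reduce
    rw [hR n hn0 c hc, mul_right_comm, ← Complex.exp_add, add_neg_cancel, Complex.exp_zero, one_mul]
  refine ⟨(continuousOn_const.mul hφ).add (hRc.clog hslit), ?_, fun c hc => ?_⟩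
  · have h := hR n hn0 0 (by simpa using hc₀)
    rw [genMultinomialSum_zero, hb, one_pow, hφ0, mul_zero, Complex.exp_zero, one_mul] at h
    simp [hφ0, ← h]
  · rw [Complex.exp_add, Complex.exp_log (Complex.slitPlane_ne_zero (hslit c hc)), hR n hn0 c hc]

theorem csqrt_mul_mem_closedBall {c y : 𝒜 → ℂ} {ε r : ℝ} (hε : 0 < ε) (hr : 0 ≤ r)
    (hc : ∀ α, ‖c α‖ ≤ ε) (hy : y ∈ polydisc 𝒜 (r / √ε)) :
    (fun α => csqrt (c α) * y α) ∈ Metric.closedBall (0 : 𝒜 → ℂ) r := by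
  rw [mem_closedBall_zero_iff, pi_norm_le_iff_of_nonneg hr]
  intro α
  rw [norm_mul, norm_csqrt]
  calc √‖c α‖ * ‖y α‖ ≤ √ε * (r / √ε) := by
        have h1 := hc α
        have h2 := hy α
        gcongr
    _ = r := mul_div_cancel₀ _ (by positivity)

theorem continuousOn_meanFieldEnergy {A : 𝒜 → 𝒮 → ℂ} {b : 𝒮 → ℂ} {μ : (𝒜 → ℂ) → (𝒜 → ℂ)}
    {s : Set (𝒜 → ℂ)} (hμ : ContinuousOn μ s)
    (hs : ∀ c ∈ s, laplace A b (fun α => 2 * c α * μ c α) ∈ Complex.slitPlane) :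
    ContinuousOn (fun c => meanFieldEnergy A b c (μ c)) s := by
  have hμα : ∀ α, ContinuousOn (fun c => μ c α) s := fun α => continuousOn_pi.1 hμ α
  unfold meanFieldEnergy
  refine ContinuousOn.add ?_ (ContinuousOn.clog ?_ hs)
  · fun_prop
  · refine (contDiff_laplace A b).continuous.comp_continuousOn ?_
    fun_prop

end GenMultinomial

/-! ### Assembly of the proposition. -/

theorem mainTheorem10 {𝒜 𝒮 : Type*} [Fintype 𝒜] [Fintype 𝒮] [DecidableEq 𝒮]
    (A : 𝒜 → 𝒮 → ℂ) (b : 𝒮 → ℂ) (hb : ∑ s, b s = 1) :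
    ∃ c₀ : ℝ, 0 < c₀ ∧ ∃ r : ℝ, 0 < r ∧ ∃ K : ℝ,
      ∃ (yStar : (𝒜 → ℂ) → (𝒜 → ℂ)) (L : ℕ → (𝒜 → ℂ) → ℂ),
        GenMultinomial.IsContinuousLogS1 A b c₀ L ∧
        ∀ ε : ℝ, 0 < ε → ε ≤ c₀ → ∀ c : 𝒜 → ℂ, (∀ α, ‖c α‖ ≤ ε) →
          -- the logarithm in `Φ` is defined and holomorphic on the polydisc of radius `r / √ε`
          (∀ y ∈ GenMultinomial.polydisc 𝒜 (r / √ε),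
            GenMultinomial.partitionFn A b c y ∈ Complex.slitPlane) ∧
          -- `yStar c` is the unique critical point of `Φ` there
          yStar c ∈ GenMultinomial.polydisc 𝒜 (r / √ε) ∧
          GenMultinomial.IsCriticalPoint (GenMultinomial.phi A b c) (yStar c) ∧
          (∀ y ∈ GenMultinomial.polydisc 𝒜 (r / √ε),
            GenMultinomial.IsCriticalPoint (GenMultinomial.phi A b c) y → y = yStar c) ∧
          -- and the unique fixed point of the explicit map there
          GenMultinomial.fixedPointMap A b c (yStar c) = yStar c ∧
          (∀ y ∈ GenMultinomial.polydisc 𝒜 (r / √ε),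
            GenMultinomial.fixedPointMap A b c y = y → y = yStar c) ∧
          -- the exponential scaling of the sum
          Filter.Tendsto (fun n : ℕ => L n c / (n : ℂ)) Filter.atTop
            (nhds (GenMultinomial.phi A b c (yStar c))) ∧
          -- the leading orders of the critical point and of the exponent
          (∀ α, ‖yStar c α - 2 * GenMultinomial.csqrt (c α) * ∑ s, b s * A α s‖
            ≤ K * ε ^ (3 / 2 : ℝ)) ∧
          ‖GenMultinomial.phi A b c (yStar c) - ∑ α, c α * (∑ s, b s * A α s) ^ 2‖
            ≤ K * ε ^ (3 / 2 : ℝ) := by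
  classical
  obtain ⟨r, hr, M, C, W, K, hM0, hC0, hK, hbd⟩ := GenMultinomial.exists_laplace_bounds (A := A) hb
  -- `‖A‖ + M` bounds the recentred matrix `A - μ c`. As `ε₀` depends only on this bound and on `W`,
  -- it serves all the tilted weights at once.
  obtain ⟨ε₀, hε₀, hsmall⟩ :=
    GenMultinomial.exists_norm_genMultinomialSum_sub_one_le 𝒜 W (‖A‖ + M)
  have hK0 : (0 : ℝ) ≤ K := K.2
  obtain ⟨c₀, hc₀, hc1, hcr, hcK, hcε⟩ : ∃ c₀ : ℝ, 0 < c₀ ∧ c₀ ≤ 1 ∧ 2 * c₀ * M ≤ r ∧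
      2 * c₀ * K ≤ 1 / 2 ∧ c₀ ≤ ε₀ := by
    refine ⟨min (min 1 ε₀) (min (r / (2 * (M + 1))) (1 / (4 * (K + 1)))), by positivity,
      (min_le_left _ _).trans (min_le_left _ _), ?_, ?_,
      (min_le_left _ _).trans (min_le_right _ _)⟩
    · have h : min (min 1 ε₀) (min (r / (2 * (M + 1))) (1 / (4 * (K + 1)))) ≤
        r / (2 * (M + 1)) := (min_le_right _ _).trans (min_le_left _ _)
      rw [le_div_iff₀ (by positivity)] at h
      have : 0 ≤ min (min 1 ε₀) (min (r / (2 * (M + 1))) (1 / (4 * ((K : ℝ) + 1)))) := by positivity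
      linarith
    · have h : min (min 1 ε₀) (min (r / (2 * (M + 1))) (1 / (4 * (K + 1)))) ≤
        1 / (4 * ((K : ℝ) + 1)) := (min_le_right _ _).trans (min_le_right _ _)
      rw [le_div_iff₀ (by positivity)] at h
      have : 0 ≤ min (min 1 ε₀) (min (r / (2 * (M + 1))) (1 / (4 * ((K : ℝ) + 1)))) := by positivity
      linarith
  obtain ⟨μ, hμc, hμ⟩ := GenMultinomial.exists_fixedPoint_two_mul_mul hK (fun u hu => (hbd u hu).2.1)
    hM0 hc₀.le hcr hcK
  have hu : ∀ c ∈ Metric.closedBall (0 : 𝒜 → ℂ) c₀,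
      (fun α => 2 * c α * μ c α) ∈ Metric.closedBall (0 : 𝒜 → ℂ) r := by
    intro c hc
    have h1 := (hμ c hc).1
    rw [mem_closedBall_zero_iff] at hc ⊢
    refine (GenMultinomial.norm_two_mul_mul_le _ _).trans (le_trans ?_ hcr)
    gcongr
  have hm₀ : ∀ α, GenMultinomial.tiltMean A b 0 α = ∑ s, b s * A α s := by
    intro α
    simp [GenMultinomial.tiltMean, GenMultinomial.tilt, GenMultinomial.laplace_zero, hb]
  let R : ℕ → (𝒜 → ℂ) → ℂ := fun n c => GenMultinomial.genMultinomialSum 1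
    (fun α s => A α s - μ c α) (GenMultinomial.tilt A b (fun α => 2 * c α * μ c α)) c n
  have hR1 : ∀ n, n ≠ 0 → ∀ c ∈ Metric.closedBall (0 : 𝒜 → ℂ) c₀, ‖R n c - 1‖ ≤ 1 / 2 := by
    intro n hn c hc
    obtain ⟨hslit, -, hW, -⟩ := hbd _ (hu c hc)
    obtain ⟨hμM, hfix, -⟩ := hμ c hc
    have hsum := GenMultinomial.sum_tilt (Complex.slitPlane_ne_zero hslit)
    refine hsmall _ _ c n hn hsum (fun α => ?_) hW (fun α s => ?_) fun α => ?_
    · simp_rw [mul_sub]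
      rw [Finset.sum_sub_distrib, ← Finset.sum_mul, hsum, one_mul, sub_eq_zero]
      -- The fixed point equation is precisely the centring condition.
      exact congrFun hfix α
    · exact (norm_sub_le _ _).trans (add_le_add
        ((norm_le_pi_norm (A α) s).trans (norm_le_pi_norm A α))
        ((norm_le_pi_norm (μ c) α).trans hμM))
    · rw [mem_closedBall_zero_iff] at hc
      exact (norm_le_pi_norm c α).trans (hc.trans hcε)
  have hRφ : ∀ n, n ≠ 0 → ∀ c ∈ Metric.closedBall (0 : 𝒜 → ℂ) c₀,
      GenMultinomial.genMultinomialSum 1 A b c n =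
        Complex.exp (n * GenMultinomial.meanFieldEnergy A b c (μ c)) * R n c := fun n hn c hc =>
    GenMultinomial.genMultinomialSum_one_eq_exp_mul (μ c) c
      (Complex.slitPlane_ne_zero (hbd _ (hu c hc)).1) hn
  refine ⟨c₀, hc₀, r, hr, max (4 * K * M) (4 * C * M ^ 2 + Fintype.card 𝒜 * (2 * K * M) ^ 2),
    fun c α => 2 * GenMultinomial.csqrt (c α) * μ c α,
    fun n c => n * GenMultinomial.meanFieldEnergy A b c (μ c) + Complex.log (R n c),
    GenMultinomial.isContinuousLogS1_mul_add_log hb hc₀.le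
      (GenMultinomial.continuousOn_meanFieldEnergy hμc fun c hc => (hbd _ (hu c hc)).1)
      ?_ hRφ hR1, ?_⟩
  · have : (fun α => 2 * (0 : 𝒜 → ℂ) α * μ 0 α) = 0 := by ext; simp
    rw [GenMultinomial.meanFieldEnergy, this, GenMultinomial.laplace_zero, hb]
    simp
  intro ε hε hεc c hcα
  have hcε' : ‖c‖ ≤ ε := (pi_norm_le_iff_of_nonneg hε.le).2 hcα
  have hc : c ∈ Metric.closedBall (0 : 𝒜 → ℂ) c₀ := by
    rw [mem_closedBall_zero_iff]
    exact hcε'.trans hεc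
  obtain ⟨hμM, hfix, huniq⟩ := hμ c hc
  have hsqε : 0 < √ε := Real.sqrt_pos.2 hε
  have hslit : ∀ y ∈ GenMultinomial.polydisc 𝒜 (r / √ε),
      GenMultinomial.partitionFn A b c y ∈ Complex.slitPlane := by
    intro y hy
    rw [GenMultinomial.partitionFn_eq_laplace]
    exact (hbd _ (GenMultinomial.csqrt_mul_mem_closedBall hε hr.le hcα hy)).1
  have hyM : ∀ (m : 𝒜 → ℂ) α, ‖2 * GenMultinomial.csqrt (c α) * m α‖ ≤ 2 * √ε * ‖m‖ := by
    intro m α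
    rw [norm_mul, norm_mul, Complex.norm_ofNat, GenMultinomial.norm_csqrt]
    have h1 := hcα α
    have h2 := norm_le_pi_norm m α
    gcongr
  have hmem : (fun α => 2 * GenMultinomial.csqrt (c α) * μ c α) ∈
      GenMultinomial.polydisc 𝒜 (r / √ε) := by
    intro α
    refine (hyM _ α).trans ?_
    rw [le_div_iff₀ hsqε]
    calc 2 * √ε * ‖μ c‖ * √ε = 2 * (√ε * √ε) * ‖μ c‖ := by ring
      _ = 2 * ε * ‖μ c‖ := by rw [Real.mul_self_sqrt hε.le]
      _ ≤ 2 * c₀ * M := by gcongr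
      _ ≤ r := hcr
  have hfp : GenMultinomial.fixedPointMap A b c
      (fun α => 2 * GenMultinomial.csqrt (c α) * μ c α) =
        fun α => 2 * GenMultinomial.csqrt (c α) * μ c α := by
    funext α
    rw [GenMultinomial.fixedPointMap_apply, GenMultinomial.csqrt_mul_two_mul_csqrt_mul, hfix]
  have hfpu : ∀ y ∈ GenMultinomial.polydisc 𝒜 (r / √ε), GenMultinomial.fixedPointMap A b c y = y →
      y = fun α => 2 * GenMultinomial.csqrt (c α) * μ c α := by
    intro y hy hfy
    -- Any fixed point `y` in the polydisc has the form `2 √c m` with `m` its tilted mean, and `‖m‖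
    -- ≤ M` puts `m` within reach of the uniqueness of `μ c`.
    set m := GenMultinomial.tiltMean A b (fun α => GenMultinomial.csqrt (c α) * y α) with hm
    have hym : y = fun α => 2 * GenMultinomial.csqrt (c α) * m α := by
      funext α
      rw [hm, ← GenMultinomial.fixedPointMap_apply, hfy]
    have hmM : ‖m‖ ≤ M := (hbd _ (GenMultinomial.csqrt_mul_mem_closedBall hε hr.le hcα hy)).2.1
    have hmm : m = μ c := by
      refine huniq m hmM ?_
      have h := GenMultinomial.csqrt_mul_two_mul_csqrt_mul c m
      rw [← h]
      simp_rw [← congrFun hym]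
      exact hm.symm
    rw [hym, hmm]
  -- Both are values of the Lipschitz tilted mean, at `2 c μ` and at `0`; the prefactor `2 √c` of
  -- `yStar` later adds the missing `√ε`.
  have hdiff : ‖μ c - GenMultinomial.tiltMean A b 0‖ ≤ 2 * K * M * ε := by
    have h := hK.norm_sub_le (hu c hc) (y := 0) (by simpa using hr.le)
    rw [hfix, sub_zero] at h
    calc _ ≤ (K : ℝ) * (2 * ε * M) := by
          refine h.trans (mul_le_mul_of_nonneg_left ?_ hK0)
          refine (GenMultinomial.norm_two_mul_mul_le c (μ c)).trans ?_
          gcongr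
      _ = _ := by ring
  have hε32 : ε ^ (3 / 2 : ℝ) = √ε * ε := by
    rw [show (3 / 2 : ℝ) = 1 / 2 + 1 by norm_num, Real.rpow_add hε, Real.rpow_one,
      Real.sqrt_eq_rpow]
  refine ⟨hslit, hmem, (GenMultinomial.isCriticalPoint_phi_iff A b c _ (hslit _ hmem)).2 hfp,
    fun y hy hcy => hfpu y hy ((GenMultinomial.isCriticalPoint_phi_iff A b c y (hslit y hy)).1 hcy),
    hfp, hfpu, ?_, fun α => ?_, ?_⟩
  · rw [GenMultinomial.phi_two_mul_csqrt_mul]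
    exact GenMultinomial.tendsto_mul_add_log_div _ fun n hn => hR1 n hn c hc
  · rw [← hm₀, ← mul_sub, hε32]
    refine (hyM (μ c - GenMultinomial.tiltMean A b 0) α).trans ?_
    calc _ ≤ 2 * √ε * (2 * K * M * ε) := by gcongr
      _ = (4 * K * M) * (√ε * ε) := by ring
      _ ≤ _ := by gcongr; exact le_max_left _ _
  · rw [GenMultinomial.phi_two_mul_csqrt_mul]
    simp_rw [← hm₀]
    refine (GenMultinomial.norm_meanFieldEnergy_sub_le (hεc.trans hc1) hC0 hcε' hμM
      (hbd _ (hu c hc)).2.2.2 hdiff).trans ?_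
    have hle : ε ^ 2 ≤ ε ^ (3 / 2 : ℝ) := by
      rw [hε32, sq]
      gcongr
      exact Real.le_sqrt_of_sq_le (by nlinarith)
    gcongr
    exact le_max_right _ _
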